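/- Let $(V,\omega)$ be a real symplectic vector space with $\dim_{\mathbb R}V=6$. Let $\mathcal U(V)$ be the set of all complex-valued alternating $3$-forms $\Omega\in\Lambda^3V^\vee\otimes\mathbb C$ that are primitive, i.e. $\omega\wedge\Omega=0$, and whose restriction $\Omega|_L\in\Lambda^3L^\vee\otimes\mathbb C$ to every Lagrangian subspace $L\subset V$ is non-zero. A complex structure $J$ on $V$ (a linear map $J:V\to V$ with $J^2=-1$) is called compatible if $\omega(Jv,Jw)=\omega(v,w)$ for all $v,w\in V$ and $\omega(v,Jv)>0$ for all $v\neq 0$; a complex-valued $3$-form is of type $(3,0)$ with respect to $J$ if it is complex multilinear, where $J$ acts on $V$ as multiplication by $i$. **Proposition.** For every $\Omega\in\mathcal U(V)$ there are compatible complex structures $J_1,J_2$ on $V$ (not necessarily distinct) and primitive complex-valued $3$-forms $\Omega_1,\Omega_2$ on $V$ such that $\Omega_k$ is of type $(3,0)$ with respect to $J_k$ for $k=1,2$, and $$\Omega=\mathrm{Re}(\Omega_1)+i\,\mathrm{Im}(\Omega_2).$$ -/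

import Mathlib

/-- A symplectic form on a real vector space `V`: a nondegenerate alternating 2-form. -/
def IsSymplecticForm {V : Type*} [AddCommGroup V] [Module ℝ V]
    (ω : V [⋀^Fin 2]→ₗ[ℝ] ℝ) : Prop :=
  ∀ v : V, (∀ w : V, ω ![v, w] = 0) → v = 0

/-- The wedge product `η ∧ α` of a real 2-form with a complex-valued `n`-form (sum over
shuffles), as an alternating map in `2 + n` variables indexed by `Fin 2 ⊕ Fin n`. The values in
`ℝ ⊗ ℂ` are multiplied out to `ℂ`. -/
noncomputable def wedgeTwo {V : Type*} [AddCommGroup V] [Module ℝ V] {n : ℕ}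
    (η : V [⋀^Fin 2]→ₗ[ℝ] ℝ) (α : V [⋀^Fin n]→ₗ[ℝ] ℂ) :
    V [⋀^(Fin 2 ⊕ Fin n)]→ₗ[ℝ] ℂ :=
  (TensorProduct.lid ℝ ℂ).toLinearMap.compAlternatingMap (η.domCoprod α)

/-- A complex-valued form of middle degree `n` on a symplectic vector space of dimension `2n` is
primitive if `ω ∧ Ω = 0`. -/
def IsPrimitiveForm {V : Type*} [AddCommGroup V] [Module ℝ V] {n : ℕ}
    (ω : V [⋀^Fin 2]→ₗ[ℝ] ℝ) (Ω : V [⋀^Fin n]→ₗ[ℝ] ℂ) : Prop :=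
  wedgeTwo ω Ω = 0

/-- A Lagrangian subspace: isotropic of half the dimension. -/
def IsLagrangian {V : Type*} [AddCommGroup V] [Module ℝ V]
    (ω : V [⋀^Fin 2]→ₗ[ℝ] ℝ) (L : Submodule ℝ V) : Prop :=
  (∀ v ∈ L, ∀ w ∈ L, ω ![v, w] = 0) ∧ 2 * Module.finrank ℝ L = Module.finrank ℝ V

/-- The set `𝒰(V)` (for `dim V = 2n`) of primitive complex-valued `n`-forms whose pullback to
every Lagrangian subspace is non-zero. -/
def lagrangianNonvanishing {V : Type*} [AddCommGroup V] [Module ℝ V]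
    (ω : V [⋀^Fin 2]→ₗ[ℝ] ℝ) (n : ℕ) : Set (V [⋀^Fin n]→ₗ[ℝ] ℂ) :=
  {Ω | IsPrimitiveForm ω Ω ∧
    ∀ L : Submodule ℝ V, IsLagrangian ω L → Ω.compLinearMap L.subtype ≠ 0}

/-- `J` is a complex structure compatible with `ω`: `J² = -1`, `J` preserves `ω`, and `ω(v, J v)`
is positive for `v ≠ 0` (so that `ω(·, J ·)` is a Euclidean inner product). -/
structure IsCompatibleComplexStructure {V : Type*} [AddCommGroup V] [Module ℝ V]
    (ω : V [⋀^Fin 2]→ₗ[ℝ] ℝ) (J : V →ₗ[ℝ] V) : Prop where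
  sq_eq_neg : ∀ v : V, J (J v) = -v
  preserves : ∀ v w : V, ω ![J v, J w] = ω ![v, w]
  pos : ∀ v : V, v ≠ 0 → 0 < ω ![v, J v]

/-- A complex-valued `n`-form is of type `(n,0)` with respect to `J` if it is complex linear in
every variable, where `J` acts on `V` as multiplication by `i`. -/
def IsTypeTop {V : Type*} [AddCommGroup V] [Module ℝ V] {n : ℕ}
    (J : V →ₗ[ℝ] V) (Ω : V [⋀^Fin n]→ₗ[ℝ] ℂ) : Prop :=
  ∀ (v : Fin n → V) (k : Fin n), Ω (Function.update v k (J (v k))) = Complex.I * Ω v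

/-! Write `Ω = ρ + iσ` with `ρ`, `σ` real and primitive. It suffices to make `ρ` the real part of a
(3,0)-form; by symmetry `σ` is one too, and multiplication by `i` turns it into an imaginary part.

Define `T x` by `ω (T x y, z) = ρ (x, y, z)`. It is ω-self-adjoint and kills `x`, so it acts on the
4-dimensional space `x^⊥/x`; primitivity makes this action traceless. A traceless self-adjoint
operator on a 4-dimensional symplectic space squares to a scalar. The full form on `V` is `T x (T x
y) = q(x) y + ω(x, y) K x - ω(K x, y) x`, where `K` is skew and `q(x) = ω(K x, x) = tr((T x)²)/4`
(`IsDarbouxBasis.contraction_identity`).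

If `q(x) ≥ 0` for some `x ≠ 0`, then `T x` has a real eigenvector `y` on `x^⊥/x`. Any `z` orthogonal
to `x` and `y` then gives `ρ (x, y, z) = 0`, and there is room to impose `σ (x, y, z) = 0` as well:
`Ω` vanishes on a Lagrangian (`exists_linearIndependent_isotropic`). So `q` is negative definite.
The identity then forces `K² = c` with `c < 0`, and `J = K/√(-c)` is compatible with `T x (J y) = T
(J x) y` (`exists_complexStructure`). Consequently `ρ + i ρ(J·, J·, J·)` is of type (3,0). -/

/-! ### The wedge product as a sum over ten shuffles -/

open Equiv in
/-- Representatives of the `(2, 3)`-shuffles. -/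
def shuffleTwoThree : Fin 10 → Perm (Fin 2 ⊕ Fin 3) :=
  ![1, swap (Sum.inl 0) (Sum.inr 0), swap (Sum.inl 0) (Sum.inr 1),
    swap (Sum.inl 0) (Sum.inr 2), swap (Sum.inl 1) (Sum.inr 0),
    swap (Sum.inl 1) (Sum.inr 1), swap (Sum.inl 1) (Sum.inr 2),
    swap (Sum.inl 0) (Sum.inr 0) * swap (Sum.inl 1) (Sum.inr 1),
    swap (Sum.inl 0) (Sum.inr 0) * swap (Sum.inl 1) (Sum.inr 2),
    swap (Sum.inl 0) (Sum.inr 1) * swap (Sum.inl 1) (Sum.inr 2)]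

/-- Permutations in the same coset of `S₂ × S₃` differ by one that preserves the two blocks. -/
theorem shuffleTwoThree_separated :
    ∀ i j, (∀ a : Fin 2, (((shuffleTwoThree i)⁻¹ * shuffleTwoThree j) (Sum.inl a)).isLeft) →
      i = j := by
  decide

open Equiv in
theorem shuffleTwoThree_bijective : Function.Bijective
    (fun i => (Quotient.mk'' (shuffleTwoThree i) : Perm.ModSumCongr (Fin 2) (Fin 3))) := by
  rw [Fintype.bijective_iff_injective_and_card]
  constructor
  · intro i j h
    refine shuffleTwoThree_separated i j fun a => ?_
    obtain ⟨⟨s, t⟩, h⟩ := QuotientGroup.leftRel_apply.mp (Quotient.exact' h)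
    rw [← h]
    rfl
  · have h := Subgroup.card_eq_card_quotient_mul_card_subgroup
      (Perm.sumCongrHom (Fin 2) (Fin 3)).range
    have h5 : (Nat.card (Fin 2 ⊕ Fin 3)).factorial = 120 := by simp [Nat.factorial]
    have h2 : (Nat.card (Fin 2)).factorial = 2 := by simp
    have h3 : (Nat.card (Fin 3)).factorial = 6 := by simp [Nat.factorial]
    rw [← Nat.card_congr (MonoidHom.ofInjective Perm.sumCongrHom_injective).toEquiv,
      Nat.card_perm, Nat.card_prod, Nat.card_perm, Nat.card_perm, h2, h3, h5] at h
    rw [Fintype.card_fin, ← Nat.card_eq_fintype_card]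
    change 120 = Nat.card (Perm.ModSumCongr (Fin 2) (Fin 3)) * _ at h
    change 10 = Nat.card (Perm.ModSumCongr (Fin 2) (Fin 3))
    omega

theorem wedgeTwo_apply {V : Type*} [AddCommGroup V] [Module ℝ V]
    (η : V [⋀^Fin 2]→ₗ[ℝ] ℝ) (α : V [⋀^Fin 3]→ₗ[ℝ] ℂ) (v : Fin 2 ⊕ Fin 3 → V) :
    wedgeTwo η α v = ∑ i, ((Equiv.Perm.sign (shuffleTwoThree i) : ℤ) : ℂ) *
      (η ![v (shuffleTwoThree i (Sum.inl 0)), v (shuffleTwoThree i (Sum.inl 1))] *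
        α ![v (shuffleTwoThree i (Sum.inr 0)), v (shuffleTwoThree i (Sum.inr 1)),
          v (shuffleTwoThree i (Sum.inr 2))]) := by
  have key : (η.domCoprod α) v = ∑ i, AlternatingMap.domCoprod.summand η α
      (Quotient.mk'' (shuffleTwoThree i)) v := by
    rw [AlternatingMap.domCoprod_apply, sum_apply]
    exact (Fintype.sum_bijective _ shuffleTwoThree_bijective _ _ fun _ => rfl).symm
  rw [wedgeTwo, LinearMap.compAlternatingMap_apply, key, map_sum]
  refine Finset.sum_congr rfl fun i _ => ?_
  generalize shuffleTwoThree i = σ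
  have h2 : ![v (σ (Sum.inl 0)), v (σ (Sum.inl 1))] = fun i => v (σ (Sum.inl i)) := by
    ext i; fin_cases i <;> rfl
  have h3 : ![v (σ (Sum.inr 0)), v (σ (Sum.inr 1)), v (σ (Sum.inr 2))] =
      fun i => v (σ (Sum.inr i)) := by
    ext i; fin_cases i <;> rfl
  rw [h2, h3, AlternatingMap.domCoprod.summand_mk'']
  rcases Int.units_eq_one_or (Equiv.Perm.sign σ) with h | h <;>
    simp [h, MultilinearMap.domCoprod_apply]

/-! ### Primitivity as vanishing contraction with `ω` -/

section Darboux

variable {V : Type*} [AddCommGroup V] [Module ℝ V]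

/-- The matrix of the standard symplectic form on `ℝ⁶`. -/
def stdSymplectic : Fin 6 → Fin 6 → ℝ :=
  ![![0, 0, 0, 1, 0, 0], ![0, 0, 0, 0, 1, 0], ![0, 0, 0, 0, 0, 1],
    ![-1, 0, 0, 0, 0, 0], ![0, -1, 0, 0, 0, 0], ![0, 0, -1, 0, 0, 0]]

/-- A basis in which `ω` is the standard symplectic form. -/
def IsDarbouxBasis (ω : V [⋀^Fin 2]→ₗ[ℝ] ℝ) (b : Module.Basis (Fin 6) ℝ V) : Prop :=
  ∀ i j, ω ![b i, b j] = stdSymplectic i j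

/-- For every `i`, the five indices different from `i + 3`, with the index `i` last. -/
def coindex : Fin 6 → Fin 2 ⊕ Fin 3 → Fin 6 :=
  ![Sum.elim ![1, 4] ![2, 5, 0], Sum.elim ![0, 3] ![2, 5, 1], Sum.elim ![0, 3] ![1, 4, 2],
    Sum.elim ![1, 4] ![2, 5, 3], Sum.elim ![0, 3] ![2, 5, 4], Sum.elim ![0, 3] ![1, 4, 5]]

theorem exists_coindex_eq_of_ne : ∀ k m : Fin 6, m ≠ k → ∃ a, coindex (k + 3) a = m := by
  decide

theorem exists_eq_coindex_comp_perm (v : Fin 2 ⊕ Fin 3 → Fin 6) (hv : Function.Injective v) :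
    ∃ (i : Fin 6) (σ : Equiv.Perm (Fin 2 ⊕ Fin 3)), v = coindex i ∘ σ := by
  have hs : ¬ Function.Surjective v := fun h => by
    simpa using Fintype.card_le_of_surjective v h
  obtain ⟨k, hk⟩ := not_forall.mp hs
  have h : ∀ a, ∃ a', coindex (k + 3) a' = v a := fun a =>
    exists_coindex_eq_of_ne k (v a) fun e => hk ⟨a, e⟩
  choose σ hσ using h
  have hi : Function.Injective σ := fun a a' e => hv (by rw [← hσ a, ← hσ a', e])
  exact ⟨k + 3, Equiv.ofBijective σ (Finite.injective_iff_bijective.mp hi),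
    funext fun a => (hσ a).symm⟩

theorem AlternatingMap.map_swap₁₂ {M : Type*} [AddCommGroup M] [Module ℝ M]
    (α : V [⋀^Fin 3]→ₗ[ℝ] M) (x y z : V) : α ![y, x, z] = -α ![x, y, z] := by
  rw [← α.map_swap ![x, y, z] (i := 0) (j := 1) (by decide)]
  congr 1; ext i; fin_cases i <;> rfl

theorem AlternatingMap.map_swap₂₃ {M : Type*} [AddCommGroup M] [Module ℝ M]
    (α : V [⋀^Fin 3]→ₗ[ℝ] M) (x y z : V) : α ![x, z, y] = -α ![x, y, z] := by
  rw [← α.map_swap ![x, y, z] (i := 1) (j := 2) (by decide)]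
  congr 1; ext i; fin_cases i <;> rfl

theorem AlternatingMap.map_rotate {M : Type*} [AddCommGroup M] [Module ℝ M]
    (α : V [⋀^Fin 3]→ₗ[ℝ] M) (x y z : V) : α ![y, z, x] = α ![x, y, z] := by
  rw [α.map_swap₂₃, α.map_swap₁₂, neg_neg]

/-- An alternating 3-form as a trilinear map. -/
def AlternatingMap.trilinear {M : Type*} [AddCommGroup M] [Module ℝ M]
    (α : V [⋀^Fin 3]→ₗ[ℝ] M) : V →ₗ[ℝ] V →ₗ[ℝ] V →ₗ[ℝ] M :=
  LinearMap.mk₂ ℝ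
    (fun x y =>
      { toFun := fun z => α ![x, y, z]
        map_add' := fun z z' => by
          simp only [α.map_rotate _ x y]
          exact α.map_vecCons_add _ z z'
        map_smul' := fun c z => by
          simp only [α.map_rotate _ x y]
          exact α.map_vecCons_smul _ c z })
    (fun x x' y => LinearMap.ext fun z => α.map_vecCons_add _ x x')
    (fun c x y => LinearMap.ext fun z => α.map_vecCons_smul _ c x)
    (fun x y y' => LinearMap.ext fun z => by
      simp only [LinearMap.coe_mk, AddHom.coe_mk, LinearMap.add_apply, ← α.map_rotate x]
      exact α.map_vecCons_add _ y y')
    (fun c x y => LinearMap.ext fun z => by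
      simp only [LinearMap.coe_mk, AddHom.coe_mk, LinearMap.smul_apply, ← α.map_rotate x]
      exact α.map_vecCons_smul _ c y)

@[simp]
theorem AlternatingMap.trilinear_apply {M : Type*} [AddCommGroup M] [Module ℝ M]
    (α : V [⋀^Fin 3]→ₗ[ℝ] M) (x y z : V) : α.trilinear x y z = α ![x, y, z] :=
  rfl

/-- Only shuffles feeding a conjugate pair to `ω` survive. The five vectors omit the partner of `b
i`, so there are two such pairs; the summand on the right with the pair containing `b i` is zero by
repetition. -/
theorem wedgeTwo_apply_coindex {ω : V [⋀^Fin 2]→ₗ[ℝ] ℝ} {b : Module.Basis (Fin 6) ℝ V}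
    (hb : IsDarbouxBasis ω b) (α : V [⋀^Fin 3]→ₗ[ℝ] ℂ) (i : Fin 6) :
    wedgeTwo ω α (b ∘ coindex i) =
      α ![b i, b 0, b 3] + α ![b i, b 1, b 4] + α ![b i, b 2, b 5] := by
  have h0 : ∀ x y, α ![x, x, y] = 0 := fun x y =>
    α.map_eq_zero_of_eq _ (i := 0) (j := 1) rfl (by decide)
  have h0' : ∀ x y, α ![x, y, x] = 0 := fun x y =>
    α.map_eq_zero_of_eq _ (i := 0) (j := 2) rfl (by decide)
  simp only [wedgeTwo_apply, Function.comp_apply, hb _ _]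
  fin_cases i <;>
    simp [Fin.sum_univ_succ, shuffleTwoThree, Equiv.swap_apply_def, coindex, stdSymplectic,
      h0, h0', α.map_rotate (b _) (b 0) (b 3), α.map_rotate (b _) (b 1) (b 4),
      α.map_rotate (b _) (b 2) (b 5), add_comm]

theorem eq_zero_of_apply_coindex {M : Type*} [AddCommGroup M] [Module ℝ M]
    (b : Module.Basis (Fin 6) ℝ V) (A : V [⋀^(Fin 2 ⊕ Fin 3)]→ₗ[ℝ] M)
    (h : ∀ i, A (b ∘ coindex i) = 0) : A = 0 := by
  refine b.ext_alternating fun v hv => ?_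
  obtain ⟨i, σ, rfl⟩ := exists_eq_coindex_comp_perm v hv
  have h' := A.map_perm (b ∘ coindex i) σ
  rwa [h, smul_zero] at h'

theorem isPrimitiveForm_iff {ω : V [⋀^Fin 2]→ₗ[ℝ] ℝ} {b : Module.Basis (Fin 6) ℝ V}
    (hb : IsDarbouxBasis ω b) (α : V [⋀^Fin 3]→ₗ[ℝ] ℂ) :
    IsPrimitiveForm ω α ↔
      ∀ x, α ![x, b 0, b 3] + α ![x, b 1, b 4] + α ![x, b 2, b 5] = 0 := by
  constructor
  · intro h x
    have hf : (α.trilinear.flip (b 0)).flip (b 3) + (α.trilinear.flip (b 1)).flip (b 4) +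
        (α.trilinear.flip (b 2)).flip (b 5) = 0 := by
      refine b.ext fun i => ?_
      have h' := wedgeTwo_apply_coindex hb α i
      rw [show wedgeTwo ω α = 0 from h] at h'
      exact h'.symm
    simpa using LinearMap.congr_fun hf x
  · intro h
    exact eq_zero_of_apply_coindex b _ fun i => (wedgeTwo_apply_coindex hb α i).trans (h _)

end Darboux

/-! ### Existence of Darboux bases -/

section Darboux

variable {V : Type*} [AddCommGroup V] [Module ℝ V]

/-- An alternating 2-form as a bilinear form. -/
def AlternatingMap.bilinear (ω : V [⋀^Fin 2]→ₗ[ℝ] ℝ) : V →ₗ[ℝ] V →ₗ[ℝ] ℝ :=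
  have hswap : ∀ x y, ω ![y, x] = -ω ![x, y] := fun x y => by
    rw [← ω.map_swap ![x, y] (i := 0) (j := 1) (by decide)]
    congr 1; ext i; fin_cases i <;> rfl
  LinearMap.mk₂ ℝ (fun x y => ω ![x, y]) (fun x x' y => ω.map_vecCons_add _ x x')
    (fun c x y => ω.map_vecCons_smul _ c x)
    (fun x y y' => by
      rw [hswap (y + y'), hswap y, hswap y', ← neg_add]
      exact congrArg _ (ω.map_vecCons_add _ y y'))
    (fun c x y => by
      rw [hswap (c • y), hswap y, smul_neg]
      exact congrArg _ (ω.map_vecCons_smul _ c y))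

@[simp]
theorem AlternatingMap.bilinear_apply (ω : V [⋀^Fin 2]→ₗ[ℝ] ℝ) (x y : V) :
    ω.bilinear x y = ω ![x, y] :=
  rfl

theorem AlternatingMap.bilinear_isAlt (ω : V [⋀^Fin 2]→ₗ[ℝ] ℝ) : ω.bilinear.IsAlt :=
  fun _ => ω.map_eq_zero_of_eq _ (i := 0) (j := 1) rfl (by decide)

theorem exists_mem_ker_notMem [FiniteDimensional ℝ V] {W : Type*} [AddCommGroup W] [Module ℝ W]
    [FiniteDimensional ℝ W] (f : V →ₗ[ℝ] W) (P : Submodule ℝ V)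
    (h : Module.finrank ℝ W + Module.finrank ℝ P < Module.finrank ℝ V) :
    ∃ z, f z = 0 ∧ z ∉ P := by
  by_contra! hP
  have h1 := Submodule.finrank_mono (show LinearMap.ker f ≤ P from fun z hz => hP z hz)
  have h2 := f.finrank_range_add_finrank_ker
  have h3 := Submodule.finrank_le (LinearMap.range f)
  omega

theorem linearIndependent_of_stdSymplectic {B : V →ₗ[ℝ] V →ₗ[ℝ] ℝ} {v : Fin 6 → V}
    (hv : ∀ i j, B (v i) (v j) = stdSymplectic i j) : LinearIndependent ℝ v := by
  refine Fintype.linearIndependent_iff.mpr fun g hg => ?_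
  have h : ∀ j, ∑ i, g i * stdSymplectic i j = 0 := fun j => by
    simpa [hv] using congrArg (fun u => B u (v j)) hg
  have h0 := h 0
  have h1 := h 1
  have h2 := h 2
  have h3 := h 3
  have h4 := h 4
  have h5 := h 5
  simp [Fin.sum_univ_succ, stdSymplectic] at h0 h1 h2 h3 h4 h5
  intro i
  fin_cases i <;> assumption

theorem exists_isDarbouxBasis (hdim : Module.finrank ℝ V = 6) {ω : V [⋀^Fin 2]→ₗ[ℝ] ℝ}
    (hω : IsSymplecticForm ω) : ∃ b : Module.Basis (Fin 6) ℝ V, IsDarbouxBasis ω b := by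
  have : FiniteDimensional ℝ V := Module.finite_of_finrank_pos (by omega)
  set B := ω.bilinear with hB
  have hself : ∀ x, B x x = 0 := ω.bilinear_isAlt
  have hneg : ∀ x y, B y x = -B x y := fun x y => (ω.bilinear_isAlt.neg x y).symm
  have hdual : ∀ e, e ≠ 0 → ∃ w, B e w = 1 := by
    intro e he
    obtain ⟨w, hw⟩ : ∃ w, B e w ≠ 0 := by
      by_contra! h
      exact he (hω e h)
    exact ⟨(B e w)⁻¹ • w, by simp [-AlternatingMap.bilinear_apply, hw]⟩
  obtain ⟨e₀, -, he₀⟩ := exists_mem_ker_notMem (0 : V →ₗ[ℝ] Fin 0 → ℝ) ⊥ (by simp [hdim])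
  obtain ⟨f₀, hf₀⟩ := hdual e₀ (by simpa using he₀)
  obtain ⟨e₁, he₁, he₁'⟩ := exists_mem_ker_notMem ((B e₀).prod (B f₀)) ⊥ (by simp [hdim])
  obtain ⟨w₁, hw₁⟩ := hdual e₁ (by simpa using he₁')
  simp only [LinearMap.prod_apply, Function.prod, Prod.mk_eq_zero] at he₁
  obtain ⟨f₁, hf₁, hf₁a, hf₁b⟩ : ∃ f₁, B e₁ f₁ = 1 ∧ B e₀ f₁ = 0 ∧ B f₀ f₁ = 0 := by
    -- Symplectic Gram–Schmidt: remove the component of `w₁` in the plane of `e₀`, `f₀`. The pairing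
    -- with `e₁` is unchanged, since `e₁` is orthogonal to that plane.
    refine ⟨w₁ - B w₁ f₀ • e₀ + B w₁ e₀ • f₀, ?_, ?_, ?_⟩ <;>
      simp [-AlternatingMap.bilinear_apply, hself, hneg e₀ e₁, hneg f₀ e₁, hneg e₀ f₀, he₁, hw₁,
        hf₀, hneg w₁ e₀, hneg w₁ f₀]
  obtain ⟨e₂, he₂, he₂'⟩ := exists_mem_ker_notMem
    (((B e₀).prod (B f₀)).prod ((B e₁).prod (B f₁))) ⊥ (by simp [hdim])
  obtain ⟨w₂, hw₂⟩ := hdual e₂ (by simpa using he₂')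
  simp only [LinearMap.prod_apply, Function.prod, Prod.mk_eq_zero] at he₂
  obtain ⟨⟨he₂a, he₂b⟩, he₂c, he₂d⟩ := he₂
  obtain ⟨f₂, hf₂, hf₂a, hf₂b, hf₂c, hf₂d⟩ : ∃ f₂, B e₂ f₂ = 1 ∧ B e₀ f₂ = 0 ∧ B f₀ f₂ = 0 ∧
      B e₁ f₂ = 0 ∧ B f₁ f₂ = 0 := by
    refine ⟨w₂ - B w₂ f₀ • e₀ + B w₂ e₀ • f₀ - B w₂ f₁ • e₁ + B w₂ e₁ • f₁, ?_, ?_, ?_, ?_, ?_⟩ <;>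
      simp [-AlternatingMap.bilinear_apply, hself, hneg e₀ e₁, hneg f₀ e₁, hneg e₀ f₀,
        hneg e₁ f₁, hneg e₀ f₁, hneg f₀ f₁, hneg e₀ e₂, hneg f₀ e₂, hneg e₁ e₂, hneg f₁ e₂,
        he₁, he₂a, he₂b, he₂c, he₂d, hw₂, hf₀, hf₁, hf₁a, hf₁b,
        hneg w₂ e₀, hneg w₂ f₀, hneg w₂ e₁, hneg w₂ f₁]
  have hv : ∀ i j, B (![e₀, e₁, e₂, f₀, f₁, f₂] i) (![e₀, e₁, e₂, f₀, f₁, f₂] j) =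
      stdSymplectic i j := by
    intro i j
    fin_cases i <;> fin_cases j <;>
      simp [-AlternatingMap.bilinear_apply, stdSymplectic, hself, hneg e₀ e₁, hneg f₀ e₁,
        hneg e₀ f₀, hneg e₁ f₁, hneg e₀ f₁, hneg f₀ f₁, hneg e₀ e₂, hneg f₀ e₂, hneg e₁ e₂,
        hneg f₁ e₂, hneg e₀ f₂, hneg f₀ f₂, hneg e₁ f₂, hneg f₁ f₂, hneg e₂ f₂,
        he₁, he₂a, he₂b, he₂c, he₂d, hf₀, hf₁, hf₁a, hf₁b, hf₂, hf₂a, hf₂b, hf₂c, hf₂d]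
  refine ⟨basisOfLinearIndependentOfCardEqFinrank (linearIndependent_of_stdSymplectic hv)
    (by simp [hdim]), fun i j => ?_⟩
  simpa [hB] using hv i j

end Darboux

/-! ### From the quadratic identity for `T` to a complex structure -/

section Algebra

variable {V : Type*} [AddCommGroup V] [Module ℝ V]

/-- A skew operator `K`, definite for the alternating form `B` and adapted to the family `T` of
self-adjoint operators, is a negative multiple of a positive complex structure `J`, and `T` is
complex linear with respect to `J`. -/
theorem exists_complexStructure [Nontrivial V] {B : V →ₗ[ℝ] V →ₗ[ℝ] ℝ} (hB : B.IsAlt)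
    {T : V →ₗ[ℝ] V →ₗ[ℝ] V} (hT : ∀ x, T x x = 0) (hTB : ∀ x y z, B (T x y) z = B y (T x z))
    {K : V →ₗ[ℝ] V} (hK : ∀ x y, B (K x) y = -B x (K y))
    (hTK : ∀ x y, T x (T x y) = B (K x) x • y + B x y • K x - B (K x) y • x)
    (hpos : ∀ x, x ≠ 0 → B (K x) x < 0) :
    ∃ J : V →ₗ[ℝ] V, (∀ v, J (J v) = -v) ∧ (∀ v w, B (J v) (J w) = B v w) ∧
      (∀ v, v ≠ 0 → 0 < B v (J v)) ∧ ∀ x y, T x (J y) = T (J x) y := by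
  have hself : ∀ x, B x x = 0 := hB
  have hneg : ∀ x y, B y x = -B x y := fun x y => (hB.neg x y).symm
  have hTneg : ∀ x y, T y x = -T x y := fun x y => by
    have h := hT (x + y)
    simp only [map_add, LinearMap.add_apply, hT, zero_add, add_zero] at h
    exact eq_neg_of_add_eq_zero_left h
  have hTKx : ∀ x, T x (K x) = 0 := fun x => by
    rcases eq_or_ne x 0 with rfl | hx
    · simp
    have h0 : B (K x) (T x (K x)) = 0 := by
      have h1 := hTB x (K x) (K x)
      have h2 := hneg (K x) (T x (K x))
      linarith
    have h1 : B x (T x (K x)) = 0 := by rw [← hTB, hT]; simp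
    -- Computing `(T x)³ (K x)` in two ways leaves `B x (K x) • T x (K x) = 0`, and the scalar is
    -- nonzero by definiteness.
    have h2 := congrArg (T x) (hTK x (K x))
    rw [hTK x (T x (K x)), h0, h1] at h2
    simp only [zero_smul, add_zero, sub_zero, map_add, map_smul, hself] at h2
    have h3 : B x (K x) • T x (K x) = 0 := by simpa using h2.symm
    refine (smul_eq_zero.mp h3).resolve_left fun h => ?_
    have := hpos x hx
    rw [hK, h] at this
    simp at this
  have hTKxy : ∀ x y, T x (K y) = T (K x) y := fun x y => by
    have h := hTKx (x + y)
    simp only [map_add, LinearMap.add_apply, hTKx, zero_add, add_zero] at h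
    rw [hTneg y (K x)]
    exact eq_neg_of_add_eq_zero_right h
  have hKK : ∀ x, ∃ c : ℝ, K (K x) = c • x := fun x => by
    rcases eq_or_ne x 0 with rfl | hx
    · exact ⟨0, by simp⟩
    -- The left side is `T (K x) (T (K x) x) = T (K x) (T x (K x)) = 0`, so the right side expresses
    -- `K (K x)` as a multiple of `x`.
    have h := hTK (K x) x
    rw [← hTKxy x x, hTKx, map_zero, hK (K x) x, hself, neg_zero, zero_smul, sub_zero] at h
    refine ⟨-((B (K x) x)⁻¹ * B (K (K x)) (K x)), ?_⟩
    have hx' := (hpos x hx).ne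
    rw [neg_smul, mul_smul, eq_neg_iff_add_eq_zero, ← smul_eq_zero_iff_right hx', smul_add,
      smul_inv_smul₀ hx', add_comm]
    exact h.symm
  -- An operator for which every vector is an eigenvector is a scalar.
  obtain ⟨c, hc⟩ : ∃ c : ℝ, ∀ x, K (K x) = c • x := by
    obtain ⟨c, hc⟩ := (K ∘ₗ K).exists_eq_smul_id_of_forall_notLinearIndependent fun v => by
      obtain ⟨c, hc⟩ := hKK v
      rw [LinearIndependent.pair_iff]
      intro h
      have := h c (-1) (by simp [hc])
      simp at this
    exact ⟨c, fun x => LinearMap.congr_fun hc x⟩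
  have hc0 : c < 0 := by
    obtain ⟨x, hx⟩ := exists_ne (0 : V)
    have h1 := hpos x hx
    have hKx : K x ≠ 0 := fun h => by simp [h] at h1
    have h2 := hpos (K x) hKx
    rw [hc, map_smul, LinearMap.smul_apply, smul_eq_mul, hneg (K x) x] at h2
    nlinarith
  have hs : 0 < √(-c) := Real.sqrt_pos.mpr (by linarith)
  have hss : √(-c) * √(-c) = -c := Real.mul_self_sqrt (by linarith)
  have hsc : (√(-c))⁻¹ * ((√(-c))⁻¹ * c) = -1 := by
    field_simp
    rw [sq, hss, neg_neg]
  refine ⟨(√(-c))⁻¹ • K, fun v => ?_, fun v w => ?_, fun v hv => ?_, fun x y => ?_⟩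
  · simp [hc, smul_smul, hsc]
  · simp only [LinearMap.smul_apply, map_smul, smul_eq_mul, hK, hc]
    linear_combination (-B v w) * hsc
  · have := hpos v hv
    rw [hK] at this
    simp only [LinearMap.smul_apply, map_smul, smul_eq_mul]
    exact mul_pos (inv_pos.mpr hs) (by linarith)
  · simp [hTKxy]

/-- On `x^⊥/x` the operator `T x` satisfies `(T x)² = s²` with `s = √(B (K x) x)`, hence has an
eigenvector `y` there. Then `B (T x y) z` vanishes for every `z` orthogonal to `x` and `y`, which
leaves one condition free to kill `S x y z`. -/
theorem exists_linearIndependent_isotropic [FiniteDimensional ℝ V]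
    (hdim : 5 < Module.finrank ℝ V) {B : V →ₗ[ℝ] V →ₗ[ℝ] ℝ} (hB : B.IsAlt)
    {T : V →ₗ[ℝ] V →ₗ[ℝ] V} (hT : ∀ x, T x x = 0) (hTB : ∀ x y z, B (T x y) z = B y (T x z))
    {K : V →ₗ[ℝ] V}
    (hTK : ∀ x y, T x (T x y) = B (K x) x • y + B x y • K x - B (K x) y • x)
    (S : V →ₗ[ℝ] V →ₗ[ℝ] V →ₗ[ℝ] ℝ) {x : V} (hx : x ≠ 0) (hKx : 0 ≤ B (K x) x) :
    ∃ y z, LinearIndependent ℝ ![x, y, z] ∧ B x y = 0 ∧ B x z = 0 ∧ B y z = 0 ∧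
      B (T x y) z = 0 ∧ S x y z = 0 := by
  have hBT : ∀ y, B x (T x y) = 0 := fun y => by rw [← hTB, hT]; simp
  have hself : B x x = 0 := hB x
  obtain ⟨y, hxy, hy, s, t, hst⟩ : ∃ y, B x y = 0 ∧ y ∉ Submodule.span ℝ {x} ∧
      ∃ s t : ℝ, T x y = s • y + t • x := by
    obtain ⟨y, hxy, hy⟩ := exists_mem_ker_notMem (B x) (Submodule.span ℝ {x}) (by
      rw [finrank_span_singleton hx, Module.finrank_self]; omega)
    have hs := Real.mul_self_sqrt hKx
    set s := √(B (K x) x)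
    -- From `(T x - s)(T x + s) = 0` modulo `x`: either `y` has eigenvalue `-s`, or `T x y + s • y`
    -- is nonzero modulo `x` and has eigenvalue `s`.
    by_cases hu : T x y + s • y ∈ Submodule.span ℝ {x}
    · obtain ⟨t, ht⟩ := Submodule.mem_span_singleton.mp hu
      exact ⟨y, hxy, hy, -s, t, by rw [ht]; module⟩
    · refine ⟨T x y + s • y, by simp [hBT, hxy], hu, s, -B (K x) y, ?_⟩
      rw [map_add, map_smul, hTK, hxy, ← hs]
      module
  -- Three linear conditions leave a kernel of dimension at least 3, too large for the plane of `x`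
  -- and `y`.
  obtain ⟨z, hz, hz'⟩ := exists_mem_ker_notMem (((B x).prod (B y)).prod (S x y))
    (Submodule.span ℝ (Set.range ![x, y])) (by
      have := finrank_range_le_card (R := ℝ) ![x, y]
      simp only [Module.finrank_prod, Module.finrank_self, Set.finrank, Fintype.card_fin] at this ⊢
      omega)
  simp only [LinearMap.prod_apply, Function.prod, Prod.mk_eq_zero] at hz
  refine ⟨y, z, ?_, hxy, hz.1.1, hz.1.2, ?_, hz.2⟩
  · have h2 : LinearIndependent ℝ ![x, y] := by
      refine (LinearIndependent.pair_iff' hx).mpr fun a ha => hy ?_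
      exact Submodule.mem_span_singleton.mpr ⟨a, ha⟩
    have h3 := linearIndependent_finSnoc.mpr ⟨h2, hz'⟩
    have h4 : ![x, y, z] = Fin.snoc ![x, y] z := by
      ext i; fin_cases i <;> rfl
    rwa [h4]
  · rw [hst]
    simp [hz]

end Algebra

/-! ### The quadratic identity in coordinates -/

section Coordinates

/-- The symmetric bilinear form on 2-forms `β` on `ℝ⁶` (given by their matrices) obtained by
contracting both indices with the standard symplectic form. -/
noncomputable def contractTwo (β γ : Fin 6 → Fin 6 → ℝ) : ℝ :=
  (∑ k : Fin 3, ∑ l : Fin 3,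
    (β (k.castAdd 3) (l.castAdd 3) * γ (k.natAdd 3) (l.natAdd 3)
      - β (k.castAdd 3) (l.natAdd 3) * γ (k.natAdd 3) (l.castAdd 3)
      + γ (k.castAdd 3) (l.castAdd 3) * β (k.natAdd 3) (l.natAdd 3)
      - γ (k.castAdd 3) (l.natAdd 3) * β (k.natAdd 3) (l.castAdd 3))) / 4

set_option maxHeartbeats 4000000 in
theorem contraction_identity (c : Fin 6 → Fin 6 → Fin 6 → ℝ) (h1 : ∀ i j k, c i j k = -c j i k)
    (h2 : ∀ i j k, c i j k = -c i k j) (h3 : ∀ i, c i 0 3 + c i 1 4 + c i 2 5 = 0)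
    (x : Fin 6 → ℝ) (β : Fin 6 → Fin 6 → ℝ) (hβ : ∀ j k, β j k = ∑ i, x i * c i j k)
    (j k : Fin 6) (hjk : j < k) :
    ∑ l : Fin 3, (β j (l.castAdd 3) * β k (l.natAdd 3) - β j (l.natAdd 3) * β k (l.castAdd 3)) =
      contractTwo β β * stdSymplectic j k
        + (∑ i, x i * stdSymplectic i j) * contractTwo β (c k)
        - (∑ i, x i * stdSymplectic i k) * contractTwo β (c j) := by
  -- The order premises let `simp` sort indices without looping.
  have hlt : ∀ i j k, j < i → c i j k = -c j i k := fun i j k _ => h1 i j k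
  have hlt' : ∀ i j k, k < j → c i j k = -c i k j := fun i j k _ => h2 i j k
  have h0 : ∀ i k, c i i k = 0 := fun i k => by linarith [h1 i i k]
  have h0' : ∀ i k, c i k k = 0 := fun i k => by linarith [h2 i k k]
  have e0 := h3 0
  have e1 := h3 1
  have e2 := h3 2
  have e3 := h3 3
  have e4 := h3 4
  have e5 := h3 5
  simp [hlt, hlt', h0, h0'] at e0 e1 e2 e3 e4 e5
  -- Primitivity eliminates six of the twenty coefficients; the claim is a polynomial identity in
  -- the other fourteen and `x`.
  replace e0 : c 0 1 4 = -c 0 2 5 := by linarith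
  replace e1 : c 0 1 3 = c 1 2 5 := by linarith
  replace e2 : c 0 2 3 = -c 1 2 4 := by linarith
  replace e3 : c 1 3 4 = -c 2 3 5 := by linarith
  replace e4 : c 0 3 4 = c 2 4 5 := by linarith
  replace e5 : c 0 3 5 = -c 1 4 5 := by linarith
  have hβl : ∀ j k, k < j → β j k = -β k j := fun j k _ => by
    simp only [hβ, h2 _ j k, mul_neg, Finset.sum_neg_distrib]
  have hβ0 : ∀ j, β j j = 0 := fun j => by
    simp only [hβ, h0', mul_zero, Finset.sum_const_zero]
  fin_cases j <;> fin_cases k <;> first | (exfalso; revert hjk; decide) | skip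
  all_goals
    simp [contractTwo, stdSymplectic, Fin.sum_univ_six, Fin.sum_univ_three, hlt, hlt', h0, h0',
      hβl, hβ0, Fin.castAdd, Fin.natAdd, Fin.castLE]
    simp only [hβ, Fin.sum_univ_six]
    simp [hlt, hlt', h0, h0', e0, e1, e2, e3, e4, e5]
    ring

end Coordinates

/-! ### The quadratic identity without coordinates -/

section Contraction

variable {V : Type*} [AddCommGroup V] [Module ℝ V]

/-- The symmetric bilinear form `(x, y) ↦ contractTwo (ι_x R) (ι_y R)` of a trilinear form `R`. -/
noncomputable def contractThree (b : Fin 6 → V) (R : V →ₗ[ℝ] V →ₗ[ℝ] V →ₗ[ℝ] ℝ) :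
    V →ₗ[ℝ] V →ₗ[ℝ] ℝ :=
  let p (i j : Fin 6) : V →ₗ[ℝ] ℝ := (R.flip (b i)).flip (b j)
  let m (f g : V →ₗ[ℝ] ℝ) : V →ₗ[ℝ] V →ₗ[ℝ] ℝ := (LinearMap.mul ℝ ℝ).compl₁₂ f g
  (1 / 4 : ℝ) • ∑ k : Fin 3, ∑ l : Fin 3,
    (m (p (k.castAdd 3) (l.castAdd 3)) (p (k.natAdd 3) (l.natAdd 3))
      - m (p (k.castAdd 3) (l.natAdd 3)) (p (k.natAdd 3) (l.castAdd 3))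
      + m (p (k.natAdd 3) (l.natAdd 3)) (p (k.castAdd 3) (l.castAdd 3))
      - m (p (k.natAdd 3) (l.castAdd 3)) (p (k.castAdd 3) (l.natAdd 3)))

theorem contractThree_apply (b : Fin 6 → V) (R : V →ₗ[ℝ] V →ₗ[ℝ] V →ₗ[ℝ] ℝ) (x y : V) :
    contractThree b R x y =
      contractTwo (fun i j => R x (b i) (b j)) (fun i j => R y (b i) (b j)) := by
  simp only [contractThree, contractTwo, LinearMap.smul_apply, LinearMap.sum_apply,
    LinearMap.add_apply, LinearMap.sub_apply, LinearMap.compl₁₂_apply, LinearMap.mul_apply',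
    LinearMap.flip_apply, smul_eq_mul]
  rw [one_div_mul_eq_div]
  refine congrArg (· / (4 : ℝ)) (Finset.sum_congr rfl fun k _ => Finset.sum_congr rfl fun l _ => ?_)
  ring

theorem contractTwo_comm (β γ : Fin 6 → Fin 6 → ℝ) : contractTwo β γ = contractTwo γ β := by
  unfold contractTwo
  congr 1
  refine Finset.sum_congr rfl fun k _ => Finset.sum_congr rfl fun l _ => ?_
  ring

variable {ω : V [⋀^Fin 2]→ₗ[ℝ] ℝ} {b : Module.Basis (Fin 6) ℝ V}

theorem stdSymplectic_eq_sum (i j : Fin 6) : stdSymplectic i j = ∑ l : Fin 3,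
    (stdSymplectic i (l.castAdd 3) * stdSymplectic j (l.natAdd 3)
      - stdSymplectic i (l.natAdd 3) * stdSymplectic j (l.castAdd 3)) := by
  fin_cases i <;> fin_cases j <;>
    simp [Fin.sum_univ_three, stdSymplectic, Fin.castAdd, Fin.natAdd, Fin.castLE]

theorem IsDarbouxBasis.bilinear_eq_sum (hb : IsDarbouxBasis ω b) (u w : V) :
    ω.bilinear u w = ∑ l : Fin 3,
      (ω.bilinear u (b (l.castAdd 3)) * ω.bilinear w (b (l.natAdd 3))
        - ω.bilinear u (b (l.natAdd 3)) * ω.bilinear w (b (l.castAdd 3))) := by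
  have h : ω.bilinear = ∑ l : Fin 3,
      ((LinearMap.mul ℝ ℝ).compl₁₂ (ω.bilinear.flip (b (l.castAdd 3)))
          (ω.bilinear.flip (b (l.natAdd 3)))
        - (LinearMap.mul ℝ ℝ).compl₁₂ (ω.bilinear.flip (b (l.natAdd 3)))
          (ω.bilinear.flip (b (l.castAdd 3)))) := by
    refine LinearMap.ext_basis b b fun i j => ?_
    simp only [LinearMap.sum_apply, LinearMap.sub_apply, LinearMap.compl₁₂_apply,
      LinearMap.mul_apply', LinearMap.flip_apply, AlternatingMap.bilinear_apply, hb _ _]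
    exact stdSymplectic_eq_sum i j
  simpa using LinearMap.congr_fun₂ h u w

theorem IsDarbouxBasis.contraction_identity (hb : IsDarbouxBasis ω b) (ρ : V [⋀^Fin 3]→ₗ[ℝ] ℝ)
    (hρ : ∀ x, ρ ![x, b 0, b 3] + ρ ![x, b 1, b 4] + ρ ![x, b 2, b 5] = 0) (x y z : V) :
    ∑ l : Fin 3, (ρ.trilinear x y (b (l.castAdd 3)) * ρ.trilinear x z (b (l.natAdd 3))
        - ρ.trilinear x y (b (l.natAdd 3)) * ρ.trilinear x z (b (l.castAdd 3))) =
      contractThree b ρ.trilinear x x * ω.bilinear y z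
        + ω.bilinear x y * contractThree b ρ.trilinear x z
        - contractThree b ρ.trilinear x y * ω.bilinear x z := by
  set R := ρ.trilinear with hR
  set g := contractThree b R with hg
  set m := fun f h : V →ₗ[ℝ] ℝ => (LinearMap.mul ℝ ℝ).compl₁₂ f h with hm
  have key : ∑ l : Fin 3, (m ((R x).flip (b (l.castAdd 3))) ((R x).flip (b (l.natAdd 3)))
        - m ((R x).flip (b (l.natAdd 3))) ((R x).flip (b (l.castAdd 3)))) =
      g x x • ω.bilinear + m (ω.bilinear x) (g x) - m (g x) (ω.bilinear x) := by
    have hlt : ∀ i j, i < j → _ = _ := fun i j hij =>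
      _root_.contraction_identity (fun i j k => R (b i) (b j) (b k))
        (fun i j k => ρ.map_swap₁₂ (b j) (b i) (b k)) (fun i j k => ρ.map_swap₂₃ (b i) (b k) (b j))
        (fun i => hρ (b i)) (b.repr x) (fun j k => R x (b j) (b k))
        (fun j k => by
          have h := congrArg (fun u => R u (b j) (b k)) (b.sum_repr x)
          simpa only [map_sum, map_smul, LinearMap.sum_apply, LinearMap.smul_apply,
            smul_eq_mul] using h.symm) i j hij
    have hW : ∀ j, ω.bilinear x (b j) = ∑ i, b.repr x i * stdSymplectic i j := fun j => by
      have h := congrArg (fun u => ω.bilinear u (b j)) (b.sum_repr x)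
      simpa only [map_sum, map_smul, LinearMap.sum_apply, LinearMap.smul_apply, smul_eq_mul,
        AlternatingMap.bilinear_apply, hb _ _] using h.symm
    simp only [← hW, ← contractThree_apply, ← hg] at hlt
    -- Both sides are alternating in the last two vectors, so basis pairs with `i < j` suffice.
    refine LinearMap.ext_basis b b fun i j => ?_
    simp only [hm, LinearMap.smul_apply, LinearMap.sum_apply,
      LinearMap.add_apply, LinearMap.sub_apply, LinearMap.compl₁₂_apply, LinearMap.mul_apply',
      LinearMap.flip_apply, smul_eq_mul]
    rcases lt_trichotomy i j with h | rfl | h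
    · have := hlt i j h
      rw [← hb i j, ← AlternatingMap.bilinear_apply, mul_comm (ω.bilinear x (b j))] at this
      exact this
    · rw [show ω.bilinear (b i) (b i) = 0 from ω.bilinear_isAlt (b i), mul_zero, zero_add,
        mul_comm (g x (b i)), sub_self]
      exact Finset.sum_eq_zero fun l _ => by ring
    · have := hlt j i h
      rw [← hb j i, ← AlternatingMap.bilinear_apply, ← ω.bilinear_isAlt.neg (b i)] at this
      rw [← neg_inj, ← Finset.sum_neg_distrib]
      convert this using 1
      · exact Finset.sum_congr rfl fun l _ => by ring
      · ring
  have := LinearMap.congr_fun₂ key y z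
  simpa [hm, -AlternatingMap.bilinear_apply] using this

end Contraction

/-! ### Real primitive forms as real parts of (3,0)-forms -/

section RealForms

variable {V : Type*} [AddCommGroup V] [Module ℝ V]

/-- If two real 3-forms `ρ`, `σ` have no common zero on Lagrangian frames and `ρ` is primitive,
then `ρ` is the real part of a form of type `(3,0)` for a compatible complex structure. -/
theorem exists_isCompatibleComplexStructure (hdim : Module.finrank ℝ V = 6)
    {ω : V [⋀^Fin 2]→ₗ[ℝ] ℝ} (hω : IsSymplecticForm ω) {b : Module.Basis (Fin 6) ℝ V}
    (hb : IsDarbouxBasis ω b) (ρ σ : V [⋀^Fin 3]→ₗ[ℝ] ℝ)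
    (hρ : ∀ x, ρ ![x, b 0, b 3] + ρ ![x, b 1, b 4] + ρ ![x, b 2, b 5] = 0)
    (hL : ∀ x y z, LinearIndependent ℝ ![x, y, z] → ω ![x, y] = 0 → ω ![x, z] = 0 →
      ω ![y, z] = 0 → ρ ![x, y, z] = 0 → σ ![x, y, z] ≠ 0) :
    ∃ J : V →ₗ[ℝ] V, IsCompatibleComplexStructure ω J ∧
      ∀ x y z, ρ ![J x, y, z] = ρ ![x, J y, z] := by
  have : FiniteDimensional ℝ V := Module.finite_of_finrank_pos (by omega)
  have : Nontrivial V := Module.nontrivial_of_finrank_pos (R := ℝ) (by omega)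
  have hBinj : Function.Injective ω.bilinear :=
    (injective_iff_map_eq_zero _).mpr fun v hv => hω v fun w => LinearMap.congr_fun hv w
  let D : V ≃ₗ[ℝ] (V →ₗ[ℝ] ℝ) := LinearMap.linearEquivOfInjective ω.bilinear hBinj
    (Subspace.dual_finrank_eq (K := ℝ) (V := V)).symm
  have hD : ∀ f, ω.bilinear (D.symm f) = f := fun f => D.apply_symm_apply f
  let T : V →ₗ[ℝ] V →ₗ[ℝ] V := ρ.trilinear.compr₂ D.symm.toLinearMap
  let K : V →ₗ[ℝ] V := D.symm.toLinearMap ∘ₗ contractThree b ρ.trilinear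
  have hT : ∀ x y, ω.bilinear (T x y) = ρ.trilinear x y := fun x y => hD _
  have hK : ∀ x, ω.bilinear (K x) = contractThree b ρ.trilinear x := fun x => hD _
  have hneg : ∀ x y, ω.bilinear y x = -ω.bilinear x y := fun x y =>
    (ω.bilinear_isAlt.neg x y).symm
  have hTx : ∀ x, T x x = 0 := fun x => hBinj <| LinearMap.ext fun z => by
    rw [hT, map_zero]
    exact ρ.map_eq_zero_of_eq _ (i := 0) (j := 1) rfl (by decide)
  have hTB : ∀ x y z, ω.bilinear (T x y) z = ω.bilinear y (T x z) := fun x y z => by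
    rw [hneg (T x z) y, hT, hT]
    exact ρ.map_swap₂₃ x z y
  have hKB : ∀ x y, ω.bilinear (K x) y = -ω.bilinear x (K y) := fun x y => by
    rw [hneg (K y) x, hK, hK, contractThree_apply, contractThree_apply, contractTwo_comm, neg_neg]
  have hTK : ∀ x y, T x (T x y) =
      ω.bilinear (K x) x • y + ω.bilinear x y • K x - ω.bilinear (K x) y • x := fun x y =>
    hBinj <| LinearMap.ext fun z => by
      rw [hTB, hb.bilinear_eq_sum]
      simp only [hT, map_add, map_sub, map_smul, LinearMap.add_apply, LinearMap.sub_apply,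
        LinearMap.smul_apply, smul_eq_mul, hK]
      exact hb.contraction_identity ρ hρ x y z
  -- Non-vanishing on Lagrangians enters only here.
  have hpos : ∀ x, x ≠ 0 → ω.bilinear (K x) x < 0 := fun x hx => by
    by_contra! h
    obtain ⟨y, z, hli, hxy, hxz, hyz, hTz, hσ⟩ := exists_linearIndependent_isotropic
      (by omega) ω.bilinear_isAlt hTx hTB hTK σ.trilinear hx h
    rw [hT] at hTz
    exact hL x y z hli hxy hxz hyz hTz hσ
  obtain ⟨J, hJ1, hJ2, hJ3, hJT⟩ :=
    exists_complexStructure ω.bilinear_isAlt hTx hTB hKB hTK hpos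
  refine ⟨J, ⟨hJ1, hJ2, hJ3⟩, fun x y z => ?_⟩
  have h := congrArg (fun u => ω.bilinear u z) (hJT x y)
  simp only [hT] at h
  exact h.symm

/-- The complex-valued form `ρ(v) + i ρ(J v)`. -/
noncomputable def complexify (ρ : V [⋀^Fin 3]→ₗ[ℝ] ℝ) (J : V →ₗ[ℝ] V) : V [⋀^Fin 3]→ₗ[ℝ] ℂ :=
  Complex.ofRealCLM.toLinearMap.compAlternatingMap ρ +
    (Complex.I • Complex.ofRealCLM.toLinearMap).compAlternatingMap (ρ.compLinearMap J)

theorem complexify_apply (ρ : V [⋀^Fin 3]→ₗ[ℝ] ℝ) (J : V →ₗ[ℝ] V) (v : Fin 3 → V) :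
    complexify ρ J v = (ρ v : ℂ) + Complex.I * (ρ (fun i => J (v i)) : ℂ) := by
  simp [complexify]

/-- Since `J` moves freely between arguments, applying it to two of them changes the sign. So `ρ (J
x, J y, J z) = -ρ (J x, y, z)`, the imaginary part that complex linearity requires; its primitivity
is that of `ρ` evaluated at `J x`. -/
theorem exists_isTypeTop_of_isCompatible {ω : V [⋀^Fin 2]→ₗ[ℝ] ℝ} {b : Module.Basis (Fin 6) ℝ V}
    (hb : IsDarbouxBasis ω b) (ρ : V [⋀^Fin 3]→ₗ[ℝ] ℝ)
    (hρ : ∀ x, ρ ![x, b 0, b 3] + ρ ![x, b 1, b 4] + ρ ![x, b 2, b 5] = 0) {J : V →ₗ[ℝ] V}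
    (hJ : ∀ v, J (J v) = -v) (hJρ : ∀ x y z, ρ ![J x, y, z] = ρ ![x, J y, z]) :
    ∃ Ω : V [⋀^Fin 3]→ₗ[ℝ] ℂ, IsPrimitiveForm ω Ω ∧ IsTypeTop J Ω ∧ ∀ v, (Ω v).re = ρ v := by
  have hneg : ∀ x y z, ρ ![-x, y, z] = -ρ ![x, y, z] := fun x y z => by
    rw [← neg_one_smul ℝ x]
    exact (ρ.map_vecCons_smul _ _ _).trans (by simp)
  have h23 : ∀ x y z, ρ ![x, J y, J z] = -ρ ![x, y, z] := fun x y z => by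
    rw [← ρ.map_rotate x (J y), ← hJρ (J y), hJ, hneg, ρ.map_rotate]
  have h123 : ∀ x y z, ρ ![J (J x), J y, J z] = ρ ![x, y, z] := fun x y z => by
    rw [h23, hJ, hneg, neg_neg]
  have hrot : ∀ x y z, ρ ![x, y, J z] = ρ ![J x, y, z] := fun x y z => by
    rw [hJρ, ← ρ.map_rotate x y, ← hJρ, ρ.map_rotate]
  have hΩ : ∀ x y z, complexify ρ J ![x, y, z] =
      (ρ ![x, y, z] : ℂ) + Complex.I * (ρ ![J x, J y, J z] : ℂ) := fun x y z => by
    rw [complexify_apply]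
    congr 4
    ext i; fin_cases i <;> rfl
  refine ⟨complexify ρ J, (isPrimitiveForm_iff hb _).mpr fun x => ?_, fun v k => ?_, fun v => ?_⟩
  · have h1 := congrArg (fun r : ℝ => (r : ℂ)) (hρ x)
    have h2 := congrArg (fun r : ℝ => (r : ℂ)) (hρ (J x))
    push_cast at h1 h2
    simp only [hΩ, h23]
    push_cast
    linear_combination h1 - Complex.I * h2
  · obtain ⟨x, y, z, rfl⟩ : ∃ x y z, v = ![x, y, z] :=
      ⟨v 0, v 1, v 2, by ext i; fin_cases i <;> rfl⟩
    have hJx : complexify ρ J ![J x, y, z] = Complex.I * complexify ρ J ![x, y, z] := by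
      rw [hΩ, hΩ, h123, h23]
      push_cast
      linear_combination (ρ ![J x, y, z] : ℂ) * Complex.I_mul_I
    fin_cases k
    · have hu : Function.update ![x, y, z] 0 (J x) = ![J x, y, z] := by
        ext i; fin_cases i <;> rfl
      exact (congrArg _ hu).trans hJx
    · have : complexify ρ J ![x, J y, z] = complexify ρ J ![J x, y, z] := by
        rw [hΩ, hΩ, ← hJρ, ← hJρ]
      have hu : Function.update ![x, y, z] 1 (J y) = ![x, J y, z] := by
        ext i; fin_cases i <;> rfl
      exact (congrArg _ hu).trans (this.trans hJx)
    · have : complexify ρ J ![x, y, J z] = complexify ρ J ![J x, y, z] := by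
        rw [hΩ, hΩ, hrot, hrot]
      have hu : Function.update ![x, y, z] 2 (J z) = ![x, y, J z] := by
        ext i; fin_cases i <;> rfl
      exact (congrArg _ hu).trans (this.trans hJx)
  · simp [complexify_apply]

theorem compLinearMap_subtype_span_eq_zero {M : Type*} [AddCommGroup M] [Module ℝ M]
    {A : V [⋀^Fin 3]→ₗ[ℝ] M} {u : Fin 3 → V} (hu : LinearIndependent ℝ u) (h : A u = 0) :
    A.compLinearMap (Submodule.span ℝ (Set.range u)).subtype = 0 := by
  refine (Module.Basis.span hu).ext_alternating fun v hv => ?_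
  have h' := A.map_perm u (Equiv.ofBijective v (Finite.injective_iff_bijective.mp hv))
  rw [h, smul_zero] at h'
  simpa [Module.Basis.span_apply, Function.comp_def] using h'

theorem isLagrangian_span {ω : V [⋀^Fin 2]→ₗ[ℝ] ℝ} (hdim : Module.finrank ℝ V = 6) {x y z : V}
    (hli : LinearIndependent ℝ ![x, y, z]) (hxy : ω ![x, y] = 0) (hxz : ω ![x, z] = 0)
    (hyz : ω ![y, z] = 0) : IsLagrangian ω (Submodule.span ℝ (Set.range ![x, y, z])) := by
  refine ⟨fun v hv w hw => ?_, by rw [finrank_span_eq_card hli, hdim]; rfl⟩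
  obtain ⟨c, rfl⟩ := (Submodule.mem_span_range_iff_exists_fun ℝ).mp hv
  obtain ⟨d, rfl⟩ := (Submodule.mem_span_range_iff_exists_fun ℝ).mp hw
  have hself : ∀ u, ω.bilinear u u = 0 := ω.bilinear_isAlt
  have hneg : ∀ u w, ω.bilinear w u = -ω.bilinear u w := fun u w =>
    (ω.bilinear_isAlt.neg u w).symm
  rw [← AlternatingMap.bilinear_apply] at hxy hxz hyz ⊢
  simp [-AlternatingMap.bilinear_apply, Fin.sum_univ_three, hself, hxy, hxz, hyz, hneg x y,
    hneg x z, hneg y z]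

end RealForms

theorem mainTheorem10 {V : Type*} [AddCommGroup V] [Module ℝ V]
    (hdim : Module.finrank ℝ V = 6)
    (ω : V [⋀^Fin 2]→ₗ[ℝ] ℝ) (hω : IsSymplecticForm ω)
    (Ω : V [⋀^Fin 3]→ₗ[ℝ] ℂ) (hΩ : Ω ∈ lagrangianNonvanishing ω 3) :
    ∃ (J₁ J₂ : V →ₗ[ℝ] V) (Ω₁ Ω₂ : V [⋀^Fin 3]→ₗ[ℝ] ℂ),
      IsCompatibleComplexStructure ω J₁ ∧ IsCompatibleComplexStructure ω J₂ ∧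
      IsPrimitiveForm ω Ω₁ ∧ IsPrimitiveForm ω Ω₂ ∧
      IsTypeTop J₁ Ω₁ ∧ IsTypeTop J₂ Ω₂ ∧
      ∀ v : Fin 3 → V, Ω v = ((Ω₁ v).re : ℂ) + Complex.I * ((Ω₂ v).im : ℂ) := by
  obtain ⟨b, hb⟩ := exists_isDarbouxBasis hdim hω
  obtain ⟨hprim, hL⟩ := hΩ
  rw [isPrimitiveForm_iff hb] at hprim
  have hne : ∀ x y z, LinearIndependent ℝ ![x, y, z] → ω ![x, y] = 0 → ω ![x, z] = 0 →
      ω ![y, z] = 0 → Ω ![x, y, z] ≠ 0 := fun x y z hli hxy hxz hyz h =>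
    hL _ (isLagrangian_span hdim hli hxy hxz hyz) (compLinearMap_subtype_span_eq_zero hli h)
  let ρ : V [⋀^Fin 3]→ₗ[ℝ] ℝ := Complex.reCLM.toLinearMap.compAlternatingMap Ω
  let σ : V [⋀^Fin 3]→ₗ[ℝ] ℝ := Complex.imCLM.toLinearMap.compAlternatingMap Ω
  have hρ : ∀ x, ρ ![x, b 0, b 3] + ρ ![x, b 1, b 4] + ρ ![x, b 2, b 5] = 0 := fun x =>
    congrArg Complex.re (hprim x)
  have hσ : ∀ x, σ ![x, b 0, b 3] + σ ![x, b 1, b 4] + σ ![x, b 2, b 5] = 0 := fun x =>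
    congrArg Complex.im (hprim x)
  obtain ⟨J₁, hJ₁, hJρ⟩ := exists_isCompatibleComplexStructure hdim hω hb ρ σ hρ
    fun x y z hli hxy hxz hyz h1 h2 => hne x y z hli hxy hxz hyz (Complex.ext h1 h2)
  obtain ⟨J₂, hJ₂, hJσ⟩ := exists_isCompatibleComplexStructure hdim hω hb σ ρ hσ
    fun x y z hli hxy hxz hyz h1 h2 => hne x y z hli hxy hxz hyz (Complex.ext h2 h1)
  obtain ⟨Ω₁, hΩ₁p, hΩ₁t, hΩ₁⟩ := exists_isTypeTop_of_isCompatible hb ρ hρ hJ₁.sq_eq_neg hJρ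
  obtain ⟨Ω₂, hΩ₂p, hΩ₂t, hΩ₂⟩ := exists_isTypeTop_of_isCompatible hb σ hσ hJ₂.sq_eq_neg hJσ
  rw [isPrimitiveForm_iff hb] at hΩ₂p
  -- `Ω₂` has real part `σ`; the factor `i` makes `σ` the imaginary part and preserves type and
  -- primitivity.
  refine ⟨J₁, J₂, Ω₁, Complex.I • Ω₂, hJ₁, hJ₂, hΩ₁p, (isPrimitiveForm_iff hb _).mpr fun x => ?_,
    hΩ₁t, fun v k => ?_, fun v => ?_⟩
  · simp only [AlternatingMap.smul_apply, smul_eq_mul]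
    rw [← mul_add, ← mul_add, hΩ₂p, mul_zero]
  · simp only [AlternatingMap.smul_apply, smul_eq_mul]
    rw [hΩ₂t]
  · rw [hΩ₁]
    have h : ((Complex.I • Ω₂) v).im = σ v := by simp [hΩ₂]
    rw [h]
    apply Complex.ext <;> simp [ρ, σ]
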